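/- Let $K,\kappa,\epsilon,i$ be integers with $K>2$, $\epsilon\in\{0,1\}$, $K=2\kappa-\epsilon$ and $1\le i\le\kappa$. Paths. A path starts at a point $(0,a)$ with $a\ge 0$ an even integer, and consists of finitely many moves between points of the integer lattice in the first quadrant; the moves are $(x,y)\to(x+1,y+1)$, $(x,y)\to(x+1,y-1)$ if $y\ge 1$, and $(x,0)\to(x+1,0)$. A path with at least one move ends with a move from ordinate $1$ to ordinate $0$; the path without moves is allowed only for $a=0$. A peak is a vertex of the path that is reached by a move $(+1,+1)$ and left by a move $(+1,-1)$; its height is its ordinate. The weight of a path is the sum of the abscissas of its peaks. The relative height of a peak $(x,y)$ is the largest integer $h$ for which the path has two vertices $(x',y-h)$ and $(x'',y-h)$ with $x'<x<x''$ such that between these two vertices there is no peak of height larger than $y$ and every other peak of height $y$ has abscissa larger than $x$. The charge of a path is the sum of the relative heights of its peaks. Let $P_{K,i}(N,m)$ be the number of paths of weight $N$ and charge $m$ that start at $(0,2\kappa-2i)$ and all of whose peaks have even abscissa and height at most $K-1$, and let $P_{K,i}(N)=\sum_m P_{K,i}(N,m)$. Partitions. Let $E_{K,i}(N,m)$ be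 the number of partitions $p_1\ge p_2\ge\cdots\ge p_m\ge 1$ of $N$ into $m$ parts such that every odd part occurs an even number of times, $p_j\ge p_{j+K-1}+2$ whenever $1\le j\le m-K+1$, and at most $2i-2$ parts are equal to $1$. Let $E_{K,i}(N)=\sum_m E_{K,i}(N,m)$. Then for every integer $n\ge 0$ the numbers $P_{K,i}(2n)$ and $E_{K,i}(2n)$ are finite and $$P_{K,i}(2n)=E_{K,i}(2n).$$ -/

import Mathlib

/-- A permitted change of ordinate in one unit step to the right: up by one, down by one, or
a horizontal move along the `x` axis. -/
def AllowedMove (j j' : ℕ) : Prop :=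
  j' = j + 1 ∨ j = j' + 1 ∨ (j = 0 ∧ j' = 0)

/-- A path is recorded by the nonempty list `y` of the ordinates of its vertices
`(0, y₀), (1, y₁), …`; `height y x` is the ordinate of its vertex with abscissa `x`
(to be used for `x < y.length`). -/
def height (y : List ℕ) (x : ℕ) : ℕ := y.getD x 0

/-- The vertex with abscissa `x` is a peak: it is reached by a north-east move and left by a
south-east move. -/
def IsPeak (y : List ℕ) (x : ℕ) : Prop :=
  1 ≤ x ∧ x + 1 < y.length ∧
    height y x = height y (x - 1) + 1 ∧ height y x = height y (x + 1) + 1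

instance instDecidablePredIsPeak (y : List ℕ) : DecidablePred (IsPeak y) := fun x => by
  unfold IsPeak; infer_instance

/-- The abscissas of the peaks of a path. -/
def peaks (y : List ℕ) : Finset ℕ := (Finset.range y.length).filter (IsPeak y)

/-- The weight of a path: the sum of the abscissas of its peaks. -/
def weight (y : List ℕ) : ℕ := ∑ x ∈ peaks y, x

/-- `h` is admissible for the peak `(x, height y x)`: there are vertices on the path, one on
each side of the peak, both lying `h` below it, such that between them no peak is higher than
the given one and no peak of the same height lies to the left of it. -/
def IsAdmissibleDepth (y : List ℕ) (x h : ℕ) : Prop :=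
  ∃ x₁ x₂ : ℕ, x₁ < x ∧ x < x₂ ∧ x₂ < y.length ∧
    height y x₁ + h = height y x ∧ height y x₂ + h = height y x ∧
    ∀ p ∈ peaks y, x₁ < p → p < x₂ →
      height y p ≤ height y x ∧ (height y p = height y x → x ≤ p)

/-- The relative height of the peak with abscissa `x`: the largest admissible depth. At a
peak, `1` is admissible and an admissible depth is at most `height y x`, so that the supremum
is a maximum. -/
noncomputable def relativeHeight (y : List ℕ) (x : ℕ) : ℕ :=
  sSup {h : ℕ | IsAdmissibleDepth y x h}

/-- The charge of a path: the sum of the relative heights of its peaks. -/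
noncomputable def charge (y : List ℕ) : ℕ := ∑ x ∈ peaks y, relativeHeight y x

/-- The `K`-restricted lattice paths. A path without moves is a single vertex on the `x`
axis; every other path ends with a move from ordinate `1` to ordinate `0`. -/
structure IsRestrictedPath (K : ℕ) (y : List ℕ) : Prop where
  has_vertex : y ≠ []
  even_start : Even (height y 0)
  moves : ∀ x, x + 1 < y.length → AllowedMove (height y x) (height y (x + 1))
  ends_on_axis : height y (y.length - 1) = 0
  last_move : ∀ x, x + 2 = y.length → height y x = 1
  peaks_even : ∀ x ∈ peaks y, Even x
  peaks_le : ∀ x ∈ peaks y, height y x ≤ K - 1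

/-- The `K`-restricted lattice paths of weight `N` starting at `(0, a)`. -/
def restrictedPaths (K a N : ℕ) : Set (List ℕ) :=
  {y | IsRestrictedPath K y ∧ height y 0 = a ∧ weight y = N}

/-- `P_{K,i}(N, m)`, where `K = 2κ` or `K = 2κ - 1`. -/
noncomputable def pathNumberCharge (K κ i N m : ℕ) : ℕ :=
  {y ∈ restrictedPaths K (2 * κ - 2 * i) N | charge y = m}.ncard

/-- `P_{K,i}(N)`, the sum of all the `P_{K,i}(N, m)`. -/
noncomputable def pathNumber (K κ i N : ℕ) : ℕ :=
  ∑ᶠ m : ℕ, pathNumberCharge K κ i N m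

/-- The parts of a partition in non-increasing order. -/
def sortedParts {N : ℕ} (p : N.Partition) : List ℕ := p.parts.sort (· ≥ ·)

/-- The restrictions on a partition `p₁ ≥ p₂ ≥ ⋯ ≥ p_m`: every odd part occurs an even number
of times, `p_j ≥ p_{j+K-1} + 2` for `j + K - 1 ≤ m`, and there are at most `2i - 2` parts equal
to `1`. -/
structure IsEPartition (K i : ℕ) {N : ℕ} (p : N.Partition) : Prop where
  odd_parts : ∀ a : ℕ, Odd a → Even (p.parts.count a)
  difference : ∀ j : ℕ, j + (K - 1) < (sortedParts p).length →
    (sortedParts p).getD (j + (K - 1)) 0 + 2 ≤ (sortedParts p).getD j 0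
  ones : p.parts.count 1 ≤ 2 * i - 2

/-- `E_{K,i}(N, m)`. -/
noncomputable def partitionNumberLength (K i N m : ℕ) : ℕ :=
  {p : N.Partition | IsEPartition K i p ∧ p.parts.card = m}.ncard

/-- `E_{K,i}(N)`, the sum of all the `E_{K,i}(N, m)`. -/
noncomputable def partitionNumber (K i N : ℕ) : ℕ :=
  ∑ᶠ m : ℕ, partitionNumberLength K i N m

/-! Encode a partition by its multiplicities f₁, f₂, …, preceded by a fictitious f₀ = 2κ − 2i. A
sweep (`shift`) runs from large parts to small: a nonempty cell that receives no carry passes one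
unit to the next smaller cell, which absorbs it. Thus some parts drop by one, and a unit leaving
cell 0 disappears. The successive values of f₀ under sweeping are the ordinates of a lattice path
(`path`), which goes down exactly when cell 0 emits. A sweep can be undone once its outgoing carry
is known, and the path displays that carry; so, up to trailing zeros, lists and paths correspond
bijectively (`eq_of_path_eq`, `exists_path_eq`).

Weights agree (`weight_path`): a sweep lowers the sum of the parts by the number of units emitted
from cells k ≥ 1, which is the number of peaks, and deleting the first vertex lowers the weight of
the path by the same number. The parity condition becomes the absence of peaks at odd abscissas
(`evenOnOdd_shift_shift`). The difference condition says that neighbouring multiplicities sum to at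
most K − 1, and becomes the height bound (`neighboursLe_shift`); its instance f₀ + f₁ ≤ K − 1
encodes the bound on the ones. Summing over m removes charge and number of parts from the
comparison. -/

/-! ### Sweeps of multiplicity lists -/

/-- The carry that leaves the bottom of a list of multiplicities when it is swept from the top:
a cell without incoming carry emits one if it is nonempty, and a cell absorbs an incoming carry. -/
def carry : List ℕ → Bool
  | [] => false
  | c :: l => !carry l && decide (0 < c)

/-- The multiplicities after one sweep. -/
def shift : List ℕ → List ℕ
  | [] => []
  | c :: l => (if carry l then c + 1 else c - 1) :: shift l

/-- The number of carries emitted in a sweep. -/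
def emits : List ℕ → ℕ
  | [] => 0
  | c :: l => emits l + if carry (c :: l) then 1 else 0

/-- The weight of a list of multiplicities, the first of which belongs to `k`. -/
def listWeight : ℕ → List ℕ → ℕ
  | _, [] => 0
  | k, c :: l => k * c + listWeight (k + 1) l

theorem length_shift (l : List ℕ) : (shift l).length = l.length := by
  induction l with
  | nil => rfl
  | cons c l ih => simp [shift, ih]

/-- Every emitted unit moves down by one place; the unit that leaves the list altogether would have
landed on `k`. -/
theorem listWeight_shift (k : ℕ) (l : List ℕ) :
    listWeight (k + 1) (shift l) + emits l + (if carry l then k else 0) =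
      listWeight (k + 1) l := by
  induction l generalizing k with
  | nil => simp [shift, emits, listWeight, carry]
  | cons c l ih =>
    have h := ih (k + 1)
    rcases c with _ | c <;> cases hl : carry l <;>
      simp [shift, emits, listWeight, carry, hl] at h ⊢ <;> rw [← h] <;> ring

theorem emits_shift (l : List ℕ) :
    emits l = emits (shift l) + if carry l && !carry (shift l) then 1 else 0 := by
  induction l with
  | nil => simp [shift, emits]
  | cons c l ih =>
    rcases c with _ | _ | c <;> cases hl : carry l <;> cases hs : carry (shift l) <;>
      simp_all [shift, emits, carry]

theorem emits_eq_zero {l : List ℕ} (h : emits l = 0) : l.sum = 0 := by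
  induction l with
  | nil => rfl
  | cons c l ih =>
    have hc : carry l = false := by
      cases l with
      | nil => rfl
      | cons d m =>
        simp only [emits] at h
        by_contra hd
        simp_all
    rcases c with _ | c <;> simp_all [emits, carry]

theorem carry_of_sum_eq_zero {l : List ℕ} (h : l.sum = 0) : carry l = false := by
  cases l with
  | nil => rfl
  | cons c l => simp at h; simp [carry, h.1]

theorem shift_of_sum_eq_zero {l : List ℕ} (h : l.sum = 0) : shift l = l := by
  induction l with
  | nil => rfl
  | cons c l ih =>
    have h' := h
    rw [List.sum_cons, Nat.add_eq_zero_iff] at h'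
    simp [shift, ih h'.2, carry_of_sum_eq_zero h'.2, h'.1]

theorem emits_of_sum_eq_zero {l : List ℕ} (h : l.sum = 0) : emits l = 0 := by
  induction l with
  | nil => rfl
  | cons c l ih =>
    have h' := h
    rw [List.sum_cons, Nat.add_eq_zero_iff] at h'
    simp [emits, ih h'.2, carry_of_sum_eq_zero h]

theorem listWeight_of_sum_eq_zero (k : ℕ) {l : List ℕ} (h : l.sum = 0) : listWeight k l = 0 := by
  induction l generalizing k with
  | nil => rfl
  | cons c l ih =>
    rw [List.sum_cons, Nat.add_eq_zero_iff] at h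
    simp [listWeight, ih _ h.2, h.1]

theorem listWeight_shift_lt {l : List ℕ} (h : l.sum ≠ 0) :
    listWeight 1 (shift l) < listWeight 1 l := by
  have h1 := listWeight_shift 0 l
  have h2 : emits l ≠ 0 := fun h0 => h (emits_eq_zero h0)
  simp only [zero_add] at h1
  omega

/-! ### Inverting a sweep -/

theorem eq_of_shift_eq {l m : List ℕ} (h : shift l = shift m) (hc : carry l = carry m) :
    l = m := by
  induction l generalizing m with
  | nil => cases m with
    | nil => rfl
    | cons d m => simp [shift] at h
  | cons c l ih => cases m with
    | nil => simp [shift] at h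
    | cons d m =>
      simp only [shift, List.cons.injEq] at h
      have key : carry l = carry m ∧ c = d := by
        have h1 := h.1
        cases hl : carry l <;> cases hm : carry m <;> rcases c with _ | c <;>
          rcases d with _ | d <;> simp_all [carry]
      rw [ih h.2 key.1, key.2]

theorem sum_eq_zero_of_shift {l : List ℕ} (h : (shift l).sum = 0) (hc : carry l = false) :
    l.sum = 0 := by
  have : l = shift l := eq_of_shift_eq (shift_of_sum_eq_zero h).symm
    (by rw [hc, carry_of_sum_eq_zero h])
  rwa [this]

/-- The inverse of a sweep, with given outgoing carry. -/
def unshift : Bool → List ℕ → List ℕ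
  | _, [] => []
  | b, c :: l => (if b then c + 1 else c - 1) :: unshift (!b && decide (0 < c)) l

/-- Carries are recovered from the bottom up: a cell that did not emit received a carry exactly when
it is now nonempty. The final 0 makes room for a unit at the top, so that no carry is demanded from
beyond the list. -/
theorem shift_unshift (b : Bool) (l : List ℕ) :
    shift (unshift b (l ++ [0])) = l ++ [0] ∧ carry (unshift b (l ++ [0])) = b := by
  induction l generalizing b with
  | nil => cases b <;> simp [unshift, shift, carry]
  | cons c l ih =>
    simp only [List.cons_append, unshift, shift, carry, ih]
    rcases c with _ | c <;> cases b <;> simp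

theorem shift_append_zero (l : List ℕ) :
    shift (l ++ [0]) = shift l ++ [0] ∧ carry (l ++ [0]) = carry l := by
  induction l with
  | nil => simp [shift, carry]
  | cons c l ih => simp [shift, carry, ih]

theorem headD_shift_of_carry {l : List ℕ} (h : carry l = true) :
    l.headD 0 = (shift l).headD 0 + 1 := by
  cases l with
  | nil => simp [carry] at h
  | cons c l => simp_all [carry, shift]; omega

theorem headD_shift_of_not_carry {l : List ℕ} (h : carry l = false) :
    (shift l).headD 0 = l.headD 0 + 1 ∨ l.headD 0 = 0 ∧ (shift l).headD 0 = 0 := by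
  cases l with
  | nil => simp [shift]
  | cons c l => cases hl : carry l <;> simp_all [carry, shift]

/-! ### Parity and neighbour conditions under sweeps -/

/-- All multiplicities of odd numbers are even, where the head of the list is the multiplicity
of an odd number if and only if the Boolean is `true`. -/
def EvenOnOdd : Bool → List ℕ → Prop
  | _, [] => True
  | b, c :: l => (b = true → Even c) ∧ EvenOnOdd (!b) l

/-- Two sweeps change the parity of a cell in two cases only: a lone unit leaves in the first sweep
and nothing arrives in the second, or an empty cell is reached only by the second. These are carry
patterns forbidden just below or just above an odd cell, whence the joint induction on both
parities. -/
theorem evenOnOdd_shift_shift (l : List ℕ) :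
    (EvenOnOdd true l ↔
      EvenOnOdd true (shift (shift l)) ∧ (carry l = true → carry (shift l) = true)) ∧
    (EvenOnOdd false l ↔
      EvenOnOdd false (shift (shift l)) ∧ (carry (shift l) = true → carry l = true)) := by
  induction l with
  | nil => simp [EvenOnOdd, shift, carry]
  | cons c l ih =>
    obtain ⟨h1, h2⟩ := ih
    simp only [EvenOnOdd, shift, carry, Bool.not_true, Bool.not_false, h1, h2]
    rcases c with _ | _ | c <;> cases hl : carry l <;> cases hs : carry (shift l) <;>
      simp [Nat.even_add_one, parity_simps]

/-- Neighbouring multiplicities have sum at most `k`. -/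
def NeighboursLe (k : ℕ) : List ℕ → Prop
  | [] => True
  | c :: l => c + l.headD 0 ≤ k ∧ NeighboursLe k l

/-- For neighbours c, d the sum changes in two cases. It grows if c = 0 and d absorbs a unit, but
then the cell above d is nonempty and d + 1 is within the bound. It shrinks if c emits and d = 0;
the lost bound c ≤ k survives in the pair below, or, at the head, in the extra condition. -/
theorem neighboursLe_shift (k : ℕ) (l : List ℕ) :
    NeighboursLe k l ↔
      NeighboursLe k (shift l) ∧ (carry l = true → l.headD 0 ≤ k) := by
  induction l with
  | nil => simp [NeighboursLe, shift, carry]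
  | cons c l ih =>
    simp only [NeighboursLe, shift, carry, List.headD_cons, ih]
    cases l with
    | nil =>
      rcases c with _ | c <;> simp [shift, carry, NeighboursLe]
      omega
    | cons d m =>
      simp only [NeighboursLe, shift, carry, List.headD_cons]
      rcases m with _ | ⟨e, m⟩
      · rcases c with _ | c <;> rcases d with _ | d <;> simp [shift, carry, NeighboursLe] <;> omega
      · simp only [NeighboursLe, shift, carry, List.headD_cons]
        rcases c with _ | c <;> rcases d with _ | d <;> rcases e with _ | e <;>
          obtain hm | hm := Bool.eq_false_or_eq_true (carry m) <;>
          by_cases hp : NeighboursLe k (shift m) <;> simp [hm, hp] <;> omega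

/-! ### The path of a list and its inverse -/

/-- The path of a list of multiplicities: the successive heads under sweeping. -/
def path (f : List ℕ) : List ℕ :=
  if f.sum = 0 then [0] else f.headD 0 :: path (shift f)
termination_by listWeight 1 f
decreasing_by exact listWeight_shift_lt ‹_›

theorem path_of_sum_eq_zero {f : List ℕ} (h : f.sum = 0) : path f = [0] := by
  rw [path, if_pos h]

theorem path_of_sum_ne_zero {f : List ℕ} (h : f.sum ≠ 0) :
    path f = f.headD 0 :: path (shift f) := by
  rw [path, if_neg h]

theorem path_ne_nil (f : List ℕ) : path f ≠ [] := by
  rw [path]; split_ifs <;> simp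

theorem headD_of_sum_eq_zero {f : List ℕ} (h : f.sum = 0) : f.headD 0 = 0 := by
  cases f with
  | nil => rfl
  | cons c l => simp at h; simp [h.1]

theorem height_path (f : List ℕ) (x : ℕ) : height (path f) x = (shift^[x] f).headD 0 := by
  induction x generalizing f with
  | zero =>
    by_cases h : f.sum = 0
    · rw [path_of_sum_eq_zero h]; simpa [height] using (headD_of_sum_eq_zero h).symm
    · rw [path_of_sum_ne_zero h]; simp [height]
  | succ x ih =>
    rw [Function.iterate_succ_apply, ← ih]
    by_cases h : f.sum = 0
    · rw [shift_of_sum_eq_zero h, ih, path_of_sum_eq_zero h]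
      have : shift^[x] f = f := Function.iterate_fixed (shift_of_sum_eq_zero h) x
      rw [this, headD_of_sum_eq_zero h]; simp [height]
    · rw [path_of_sum_ne_zero h]; simp [height]

theorem allowedMove_headD_shift (f : List ℕ) : AllowedMove (f.headD 0) ((shift f).headD 0) := by
  cases h : carry f
  · rcases headD_shift_of_not_carry h with h | h
    · exact Or.inl h
    · exact Or.inr (Or.inr h)
  · exact Or.inr (Or.inl (headD_shift_of_carry h))

/-- The conditions on a lattice path, apart from those on its start and its peaks. -/
structure IsLatticePath (y : List ℕ) : Prop where
  has_vertex : y ≠ []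
  moves : ∀ x, x + 1 < y.length → AllowedMove (height y x) (height y (x + 1))
  ends_on_axis : height y (y.length - 1) = 0
  last_move : ∀ x, x + 2 = y.length → height y x = 1

theorem isLatticePath_singleton (a : ℕ) : IsLatticePath [a] ↔ a = 0 := by
  constructor
  · intro h; simpa [height] using h.ends_on_axis
  · rintro rfl
    exact ⟨by simp, by simp, by simp [height], by simp⟩

theorem isLatticePath_cons_cons (a b : ℕ) (t : List ℕ) :
    IsLatticePath (a :: b :: t) ↔
      AllowedMove a b ∧ (t = [] → a = 1) ∧ IsLatticePath (b :: t) := by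
  constructor
  · intro h
    refine ⟨?_, ?_, ?_, ?_, ?_, ?_⟩
    · simpa [height] using h.moves 0 (by simp)
    · rintro rfl; simpa [height] using h.last_move 0 (by simp)
    · simp
    · intro x hx
      simpa [height] using h.moves (x + 1) (by simpa using hx)
    · simpa [height] using h.ends_on_axis
    · intro x hx
      simpa [height] using h.last_move (x + 1) (by simp at hx ⊢; omega)
  · rintro ⟨h1, h2, h3⟩
    refine ⟨by simp, ?_, ?_, ?_⟩
    · rintro (_ | x) hx
      · simpa [height] using h1
      · simpa [height] using h3.moves x (by simpa using hx)
    · simpa [height] using h3.ends_on_axis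
    · rintro (_ | x) hx
      · have : t = [] := by simpa using hx.symm
        simpa [height] using h2 this
      · simpa [height] using h3.last_move x (by simp at hx ⊢; omega)

theorem isLatticePath_path (f : List ℕ) : IsLatticePath (path f) := by
  induction f using path.induct with
  | case1 f h => rw [path_of_sum_eq_zero h, isLatticePath_singleton]
  | case2 f h ih =>
    rw [path_of_sum_ne_zero h]
    have hy := height_path (shift f) 0
    obtain ⟨b, t, hbt⟩ := List.exists_cons_of_ne_nil (path_ne_nil (shift f))
    rw [hbt] at ih hy ⊢
    have hb : b = (shift f).headD 0 := by simpa [height] using hy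
    rw [isLatticePath_cons_cons]
    refine ⟨hb ▸ allowedMove_headD_shift f, ?_, ih⟩
    rintro rfl
    have hs : (shift f).sum = 0 := by
      by_contra h0
      rw [path_of_sum_ne_zero h0] at hbt
      exact path_ne_nil _ (List.cons_eq_cons.1 hbt).2
    -- Without an outgoing carry, a sweep cannot turn a nonzero list into zeros.
    have hc : carry f = true := by
      by_contra hc
      exact h (sum_eq_zero_of_shift hs (by simpa using hc))
    rw [headD_shift_of_carry hc, headD_of_sum_eq_zero hs]

theorem eq_of_path_eq {f g : List ℕ} (h : path f = path g) (hl : f.length = g.length) :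
    f = g := by
  induction f using path.induct generalizing g with
  | case1 f hf =>
    rw [path_of_sum_eq_zero hf] at h
    have hg : g.sum = 0 := by
      by_contra hg
      rw [path_of_sum_ne_zero hg] at h
      exact path_ne_nil _ (List.cons_eq_cons.1 h).2.symm
    rw [List.sum_eq_zero_iff] at hf hg
    rw [List.eq_replicate_of_mem hf, List.eq_replicate_of_mem hg, hl]
  | case2 f hf ih =>
    rw [path_of_sum_ne_zero hf] at h
    have hg : g.sum ≠ 0 := by
      intro hg
      rw [path_of_sum_eq_zero hg] at h
      exact path_ne_nil _ (List.cons_eq_cons.1 h).2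
    rw [path_of_sum_ne_zero hg] at h
    obtain ⟨h1, h2⟩ := List.cons_eq_cons.1 h
    have hs := ih h2 (by rw [length_shift, length_shift, hl])
    refine eq_of_shift_eq hs ?_
    cases hcf : carry f <;> cases hcg : carry g
    · rfl
    · have := headD_shift_of_carry hcg
      have := headD_shift_of_not_carry hcf
      rw [hs] at this; omega
    · have := headD_shift_of_carry hcf
      have := headD_shift_of_not_carry hcg
      rw [← hs] at this; omega
    · rfl

theorem path_append_zero (f : List ℕ) : path (f ++ [0]) = path f := by
  induction f using path.induct with
  | case1 f h => rw [path_of_sum_eq_zero h, path_of_sum_eq_zero (by simpa using h)]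
  | case2 f h ih =>
    rw [path_of_sum_ne_zero h, path_of_sum_ne_zero (by simpa using h), (shift_append_zero f).1, ih]
    cases f with
    | nil => simp at h
    | cons c l => simp

theorem path_append_replicate_zero (f : List ℕ) (k : ℕ) :
    path (f ++ List.replicate k 0) = path f := by
  induction k with
  | zero => simp
  | succ k ih => rw [List.replicate_succ', ← List.append_assoc, path_append_zero, ih]

/-- Trailing zeros are invisible to the path, so both lists can be padded to a common length. -/
theorem path_eq_of_getD_eq {f g : List ℕ} (h : ∀ j, f.getD j 0 = g.getD j 0) :
    path f = path g := by
  have key : ∀ f : List ℕ, ∀ k, ∀ j, (f ++ List.replicate k 0).getD j 0 = f.getD j 0 := by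
    intro f k j
    rcases lt_or_ge j f.length with hj | hj
    · rw [List.getD_append _ _ _ _ hj]
    · rw [List.getD_append_right _ _ _ _ hj, List.getD_eq_default f _ hj]
      simp only [List.getD_eq_getElem?_getD, List.getElem?_replicate]
      split_ifs <;> rfl
  rw [← path_append_replicate_zero f g.length, ← path_append_replicate_zero g f.length]
  congr 1
  apply List.ext_getElem
  · simp [add_comm]
  · intro j h1 h2
    rw [← List.getD_eq_getElem _ 0 h1, ← List.getD_eq_getElem _ 0 h2, key, key, h]

theorem exists_path_eq {y : List ℕ} (hy : IsLatticePath y) : ∃ f, path f = y := by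
  induction y with
  | nil => exact absurd rfl hy.has_vertex
  | cons a y ih =>
    cases y with
    | nil =>
      rw [isLatticePath_singleton] at hy
      exact ⟨[], by rw [path_of_sum_eq_zero rfl, hy]⟩
    | cons b t =>
      rw [isLatticePath_cons_cons] at hy
      obtain ⟨hab, ht, hbt⟩ := hy
      obtain ⟨f, hf⟩ := ih hbt
      have hb : f.headD 0 = b := by
        have := height_path f 0
        rw [hf] at this
        simpa [height] using this.symm
      obtain ⟨hs, hc⟩ := shift_unshift (decide (a = b + 1)) f
      set g := unshift (decide (a = b + 1)) (f ++ [0]) with hg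
      have hh : (f ++ [0]).headD 0 = b := by
        rw [← hb]; cases f <;> simp
      have ha : g.headD 0 = a := by
        by_cases h : a = b + 1
        · rw [headD_shift_of_carry (by simp [hc, h]), hs, hh, h]
        · have := headD_shift_of_not_carry (hc.trans (by simp [h]))
          rw [hs, hh] at this
          unfold AllowedMove at hab
          omega
      refine ⟨g, ?_⟩
      -- Otherwise the path would have a single move, which starts at ordinate 1, while a zero list
      -- has head 0.
      have hne : g.sum ≠ 0 := by
        intro h0
        have h1 : f.sum = 0 := by
          rw [← shift_of_sum_eq_zero h0, hs] at h0
          simpa using h0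
        rw [path_of_sum_eq_zero h1] at hf
        have := ht (List.cons_eq_cons.1 hf).2.symm
        rw [headD_of_sum_eq_zero h0] at ha
        omega
      rw [path_of_sum_ne_zero hne, hs, path_append_zero, hf, ha]

/-! ### Peaks and weight -/

theorem IsLatticePath.isPeak_iff {y : List ℕ} (hy : IsLatticePath y) (x : ℕ) :
    IsPeak y x ↔ 1 ≤ x ∧ height y x = height y (x - 1) + 1 ∧ height y x = height y (x + 1) + 1 := by
  constructor
  · rintro ⟨h1, -, h2⟩; exact ⟨h1, h2⟩
  · rintro ⟨h1, h2, h3⟩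
    refine ⟨h1, ?_, h2, h3⟩
    by_contra h
    rcases (show y.length - 1 = x ∨ y.length ≤ x by omega) with h4 | h4
    · have := hy.ends_on_axis
      rw [h4] at this; omega
    · have : height y x = 0 := List.getD_eq_default _ _ h4
      omega

theorem mem_peaks {y : List ℕ} {x : ℕ} : x ∈ peaks y ↔ IsPeak y x := by
  simp only [peaks, Finset.mem_filter, Finset.mem_range, and_iff_right_iff_imp]
  rintro ⟨-, h, -⟩; omega

theorem isPeak_cons_add_two (a : ℕ) (y : List ℕ) (x : ℕ) :
    IsPeak (a :: y) (x + 2) ↔ IsPeak y (x + 1) := by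
  simp [IsPeak, height]

theorem peaks_cons (a : ℕ) (y : List ℕ) :
    peaks (a :: y) = (peaks y).image (· + 1) ∪ if IsPeak (a :: y) 1 then {1} else ∅ := by
  ext x
  rcases x with _ | _ | x
  · have h : ¬ IsPeak (a :: y) 0 := fun h => by simpa using h.1
    split_ifs <;> simp [mem_peaks, h]
  · have h : ¬ IsPeak y 0 := fun h => by simpa using h.1
    split_ifs with h1 <;> simp [mem_peaks, h, h1]
  · split_ifs <;> simp [mem_peaks, isPeak_cons_add_two]

theorem card_peaks_cons (a : ℕ) (y : List ℕ) :
    (peaks (a :: y)).card = (peaks y).card + if IsPeak (a :: y) 1 then 1 else 0 := by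
  have h : ¬ IsPeak y 0 := fun h => by simpa using h.1
  rw [peaks_cons]
  split_ifs
  · rw [Finset.card_union_of_disjoint, Finset.card_image_of_injective _ (add_left_injective 1)]
    · simp
    · simp [mem_peaks, h]
  · simp [Finset.card_image_of_injective _ (add_left_injective 1)]

/-- The new vertex pushes every old peak one step to the right and may create a peak at abscissa 1.
-/
theorem weight_cons (a : ℕ) (y : List ℕ) :
    weight (a :: y) = weight y + (peaks (a :: y)).card := by
  have h : ¬ IsPeak y 0 := fun h => by simpa using h.1
  rw [card_peaks_cons, weight, peaks_cons, weight]
  split_ifs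
  · rw [Finset.sum_union, Finset.sum_image (fun _ _ _ _ h => by simpa using h)]
    · simp [Finset.sum_add_distrib]; ring
    · simp [mem_peaks, h]
  · simp [Finset.sum_image, Finset.sum_add_distrib]

theorem isPeak_path_succ (f : List ℕ) (x : ℕ) :
    IsPeak (path f) (x + 1) ↔
      carry (shift^[x] f) = false ∧ carry (shift^[x + 1] f) = true := by
  rw [(isLatticePath_path f).isPeak_iff]
  simp only [height_path, Nat.add_sub_cancel, Function.iterate_succ_apply']
  generalize shift^[x] f = g
  cases h1 : carry g <;> cases h2 : carry (shift g)
  · have := headD_shift_of_not_carry h1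
    have := headD_shift_of_not_carry h2
    simp [-List.headD_eq_head?_getD]; omega
  · have := headD_shift_of_not_carry h1
    have := headD_shift_of_carry h2
    simp [-List.headD_eq_head?_getD]; omega
  · have := headD_shift_of_carry h1
    simp [-List.headD_eq_head?_getD]; omega
  · have := headD_shift_of_carry h1
    simp [-List.headD_eq_head?_getD]; omega

/-- By `emits_shift`, the emissions of the tail decrease by one exactly when the tail sends a unit
to the head in this sweep and none in the next, which is when the path has a peak at abscissa 1. -/
theorem card_peaks_path (f : List ℕ) : (peaks (path f)).card = emits f.tail := by
  induction f using path.induct with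
  | case1 f h =>
    rw [path_of_sum_eq_zero h, emits_of_sum_eq_zero]
    · decide
    · cases f with
      | nil => rfl
      | cons c l => simp at h ⊢; exact h.2
  | case2 f h ih =>
    have hp := isPeak_path_succ f 0
    rw [path_of_sum_ne_zero h] at hp ⊢
    rw [card_peaks_cons, ih]
    cases f with
    | nil => simp at h
    | cons c l =>
      rw [List.tail_cons, emits_shift l]
      simp only [zero_add] at hp
      simp only [hp]
      cases hl : carry l <;> cases hs : carry (shift l) <;> rcases c with _ | c <;>
        simp [shift, carry, hl, hs]

theorem listWeight_zero (f : List ℕ) : listWeight 0 f = listWeight 1 f.tail := by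
  cases f <;> simp [listWeight]

theorem weight_path (f : List ℕ) : weight (path f) = listWeight 0 f := by
  induction f using path.induct with
  | case1 f h =>
    rw [path_of_sum_eq_zero h, listWeight_of_sum_eq_zero _ h]
    decide
  | case2 f h ih =>
    have hp := card_peaks_path f
    rw [path_of_sum_ne_zero h] at hp ⊢
    rw [weight_cons, ih, hp, listWeight_zero, listWeight_zero]
    cases f with
    | nil => simp at h
    | cons c l => simpa [shift] using listWeight_shift 0 l

/-! ### Path conditions in terms of multiplicities -/

theorem exists_iterate_shift_sum_eq_zero (f : List ℕ) :
    ∃ m, ∀ x, m ≤ x → (shift^[x] f).sum = 0 := by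
  induction f using path.induct with
  | case1 f h =>
    exact ⟨0, fun x _ => by rwa [Function.iterate_fixed (shift_of_sum_eq_zero h) x]⟩
  | case2 f h ih =>
    obtain ⟨m, hm⟩ := ih
    refine ⟨m + 1, fun x hx => ?_⟩
    obtain ⟨x, rfl⟩ : ∃ z, x = z + 1 := ⟨x - 1, by omega⟩
    rw [Function.iterate_succ_apply]
    exact hm x (by omega)

theorem evenOnOdd_of_sum_eq_zero (b : Bool) {l : List ℕ} (h : l.sum = 0) : EvenOnOdd b l := by
  induction l generalizing b with
  | nil => trivial
  | cons c l ih =>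
    rw [List.sum_cons, Nat.add_eq_zero_iff] at h
    exact ⟨fun _ => by simp [h.1], ih _ h.2⟩

theorem neighboursLe_of_sum_eq_zero (k : ℕ) {l : List ℕ} (h : l.sum = 0) : NeighboursLe k l := by
  induction l with
  | nil => trivial
  | cons c l ih =>
    rw [List.sum_cons, Nat.add_eq_zero_iff] at h
    exact ⟨by rw [h.1, headD_of_sum_eq_zero h.2]; simp, ih h.2⟩

/-- Each pair of sweeps tests one odd abscissa; for the converse the condition is pulled back from
the zero list. -/
theorem evenOnOdd_iff_peaks_even (f : List ℕ) :
    EvenOnOdd false f ↔ ∀ x ∈ peaks (path f), Even x := by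
  have step : ∀ x, EvenOnOdd false (shift^[2 * x] f) ↔
      EvenOnOdd false (shift^[2 * (x + 1)] f) ∧ ¬ IsPeak (path f) (2 * x + 1) := by
    intro x
    rw [(evenOnOdd_shift_shift _).2, isPeak_path_succ, mul_add, mul_one,
      Function.iterate_succ_apply', Function.iterate_succ_apply']
    cases carry (shift^[2 * x] f) <;> simp
  constructor
  · intro h
    have hx : ∀ x, EvenOnOdd false (shift^[2 * x] f) := by
      intro x
      induction x with
      | zero => exact h
      | succ x ih => exact ((step x).1 ih).1
    intro x hp
    by_contra ho
    obtain ⟨z, rfl⟩ := Nat.not_even_iff_odd.1 ho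
    exact ((step z).1 (hx z)).2 (mem_peaks.1 hp)
  · intro h
    obtain ⟨m, hm⟩ := exists_iterate_shift_sum_eq_zero f
    have hx : ∀ x, x ≤ m → EvenOnOdd false (shift^[2 * x] f) := by
      intro x hxm
      induction hxm using Nat.decreasingInduction with
      | self => exact evenOnOdd_of_sum_eq_zero _ (hm _ (by omega))
      | of_succ x hx ih =>
        refine (step x).2 ⟨ih, fun hp => ?_⟩
        have := h _ (mem_peaks.2 hp)
        exact absurd this (by simp)
    simpa using hx 0 (Nat.zero_le m)

theorem headD_le_of_neighboursLe {k : ℕ} {f : List ℕ} (h : NeighboursLe k f) :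
    f.headD 0 ≤ k := by
  cases f with
  | nil => simp
  | cons c l => have := h.1; simp; omega

theorem neighboursLe_iff_height_le (k : ℕ) (f : List ℕ) :
    NeighboursLe k f ↔ ∀ x, height (path f) x ≤ k := by
  simp only [height_path]
  constructor
  · intro h x
    refine headD_le_of_neighboursLe ?_
    induction x with
    | zero => exact h
    | succ x ih =>
      rw [Function.iterate_succ_apply']
      exact ((neighboursLe_shift k _).1 ih).1
  · intro h
    obtain ⟨m, hm⟩ := exists_iterate_shift_sum_eq_zero f
    have hx : ∀ x, x ≤ m → NeighboursLe k (shift^[x] f) := by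
      intro x hxm
      induction hxm using Nat.decreasingInduction with
      | self => exact neighboursLe_of_sum_eq_zero _ (hm _ le_rfl)
      | of_succ x hx ih =>
        rw [Function.iterate_succ_apply'] at ih
        exact (neighboursLe_shift k _).2 ⟨ih, fun _ => h x⟩
    exact hx 0 (Nat.zero_le m)

theorem height_path_le_iff (k : ℕ) (f : List ℕ) :
    (∀ x, height (path f) x ≤ k) ↔
      f.headD 0 ≤ k ∧ ∀ x ∈ peaks (path f), height (path f) x ≤ k := by
  constructor
  · exact fun h => ⟨by simpa [height_path] using h 0, fun x _ => h x⟩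
  · rintro ⟨h0, hp⟩
    obtain ⟨m, hm⟩ := exists_iterate_shift_sum_eq_zero f
    have move : ∀ x, AllowedMove (height (path f) x) (height (path f) (x + 1)) := fun x => by
      rw [height_path, height_path, Function.iterate_succ_apply']
      exact allowedMove_headD_shift _
    -- An up move is followed by another one or ends in a peak, so the bound propagates from right
    -- to left.
    have up : ∀ x, x ≤ m → height (path f) (x + 1) = height (path f) x + 1 →
        height (path f) (x + 1) ≤ k := by
      intro x hxm
      induction hxm using Nat.decreasingInduction with
      | self =>
        intro _
        rw [height_path, headD_of_sum_eq_zero (hm _ (Nat.le_succ m))]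
        exact Nat.zero_le k
      | of_succ x hx ih =>
        intro hup
        rcases move (x + 1) with h | h | h
        · have := ih h; omega
        · exact hp _ (mem_peaks.2 (((isLatticePath_path f).isPeak_iff _).2
            ⟨by omega, by simpa using hup, h⟩))
        · omega
    intro x
    induction x with
    | zero => simpa [height_path] using h0
    | succ x ih =>
      rcases move x with h | h | h
      · rcases le_or_gt x m with hx | hx
        · exact up x hx h
        · rw [height_path, headD_of_sum_eq_zero (hm _ (by omega))]
          exact Nat.zero_le k
      · omega
      · omega

/-- Restricted paths in terms of multiplicities. -/
theorem isRestrictedPath_path_iff {K : ℕ} {f : List ℕ} (hK : f.headD 0 ≤ K - 1)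
    (he : Even (f.headD 0)) :
    IsRestrictedPath K (path f) ↔ EvenOnOdd false f ∧ NeighboursLe (K - 1) f := by
  rw [neighboursLe_iff_height_le, height_path_le_iff, evenOnOdd_iff_peaks_even]
  have h := isLatticePath_path f
  constructor
  · exact fun hp => ⟨hp.peaks_even, hK, hp.peaks_le⟩
  · rintro ⟨h1, -, h2⟩
    exact ⟨h.has_vertex, by simpa [height_path] using he, h.moves, h.ends_on_axis, h.last_move,
      h1, h2⟩

/-! ### Partitions as multiplicity lists -/

theorem evenOnOdd_iff_getD (l : List ℕ) :
    (EvenOnOdd true l ↔ ∀ j, Even j → Even (l.getD j 0)) ∧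
    (EvenOnOdd false l ↔ ∀ j, Odd j → Even (l.getD j 0)) := by
  induction l with
  | nil => simp [EvenOnOdd]
  | cons c l ih =>
    simp only [EvenOnOdd, Bool.not_true, Bool.not_false, ih]
    constructor
    · constructor
      · rintro ⟨h1, h2⟩ (_ | j) hj
        · simpa using h1
        · simpa using h2 j (by simpa [parity_simps] using hj)
      · intro h
        exact ⟨fun _ => by simpa using h 0 (by simp),
          fun j hj => by simpa using h (j + 1) (by simpa [parity_simps] using hj)⟩
    · constructor
      · rintro ⟨h1, h2⟩ (_ | j) hj
        · simp at hj
        · simpa using h2 j (by simpa [parity_simps] using hj)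
      · intro h
        exact ⟨by simp, fun j hj => by simpa using h (j + 1) (by simpa [parity_simps] using hj)⟩

theorem neighboursLe_iff_getD (k : ℕ) (l : List ℕ) :
    NeighboursLe k l ↔ ∀ j, l.getD j 0 + l.getD (j + 1) 0 ≤ k := by
  induction l with
  | nil => simp [NeighboursLe]
  | cons c l ih =>
    have hl : l.headD 0 = l.getD 0 0 := by cases l <;> simp
    rw [NeighboursLe, ih, hl]
    constructor
    · rintro ⟨h1, h2⟩ (_ | j)
      · simpa using h1
      · simpa using h2 j
    · intro h
      exact ⟨by simpa using h 0, fun j => by simpa using h (j + 1)⟩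

theorem count_add_count_succ_le_length (a : ℕ) (l : List ℕ) :
    l.count a + l.count (a + 1) ≤ l.length := by
  induction l with
  | nil => simp
  | cons c l ih =>
    simp only [List.count_cons, List.length_cons, beq_iff_eq]
    split_ifs <;> omega

theorem count_add_count_succ_eq_length {a : ℕ} {l : List ℕ} (h : ∀ x ∈ l, a ≤ x ∧ x ≤ a + 1) :
    l.count a + l.count (a + 1) = l.length := by
  induction l with
  | nil => simp
  | cons c l ih =>
    have := ih (fun x hx => h x (List.mem_cons_of_mem _ hx))
    have := h c List.mem_cons_self
    simp only [List.count_cons, List.length_cons, beq_iff_eq]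
    split_ifs <;> omega

/-- In a non-increasing list, no two entries at distance `q` differ by at most `1` if and only if
no two successive numbers together occur more than `q` times. -/
theorem difference_iff_count {s : List ℕ} (hs : s.Pairwise (· ≥ ·)) (q : ℕ) :
    (∀ j, j + q < s.length → s.getD (j + q) 0 + 2 ≤ s.getD j 0) ↔
      ∀ a, s.count a + s.count (a + 1) ≤ q := by
  constructor
  · intro h a
    by_contra hq
    induction s with
    | nil => simp at hq
    | cons c t ih =>
      rw [List.pairwise_cons] at hs
      by_cases hc : a + 1 < c
      · refine ih hs.2 (fun j hj => ?_) ?_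
        · have := h (j + 1) (by simp; omega)
          rwa [add_right_comm, List.getD_cons_succ, List.getD_cons_succ] at this
        · rw [List.count_cons_of_ne (by omega), List.count_cons_of_ne (by omega)] at hq
          exact hq
      · have hlen := count_add_count_succ_le_length a (c :: t)
        have h0 := h 0 (by omega)
        rw [zero_add, List.getD_cons_zero] at h0
        -- The entry at position q is at most c − 2 ≤ a − 1, so `a` and `a + 1` occur only among the
        -- first q entries.
        have hdrop : ∀ x ∈ (c :: t).drop q, x < a := by
          intro x hx
          have hp : ((c :: t).drop q).Pairwise (· ≥ ·) :=
            (List.pairwise_cons.2 hs).sublist (List.drop_sublist _ _)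
          rw [List.drop_eq_getElem_cons (show q < (c :: t).length by omega),
            List.pairwise_cons] at hp
          rw [List.drop_eq_getElem_cons (show q < (c :: t).length by omega), List.mem_cons] at hx
          rw [List.getD_eq_getElem _ _ (show q < (c :: t).length by omega)] at h0
          rcases hx with rfl | hx
          · omega
          · have := hp.1 x hx
            omega
        have h1 : ((c :: t).drop q).count a = 0 :=
          List.count_eq_zero_of_not_mem fun hm => by have := hdrop _ hm; omega
        have h2 : ((c :: t).drop q).count (a + 1) = 0 :=
          List.count_eq_zero_of_not_mem fun hm => by have := hdrop _ hm; omega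
        have h3 := count_add_count_succ_le_length a ((c :: t).take q)
        have h4 : ((c :: t).take q).length ≤ q := List.length_take_le _ _
        rw [← List.take_append_drop q (c :: t), List.count_append, List.count_append, h1, h2] at hq
        omega
  · intro h j hj
    by_contra hlt
    rw [List.getD_eq_getElem _ _ hj, List.getD_eq_getElem _ _ (by omega : j < s.length)] at hlt
    have hmono : ∀ u v (hu : u < s.length) (hv : v < s.length), u ≤ v → s[v] ≤ s[u] := by
      intro u v hu hv huv
      rcases huv.eq_or_lt with rfl | huv
      · exact le_rfl
      · exact List.pairwise_iff_getElem.1 hs u v hu hv huv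
    -- A violation traps q + 1 consecutive entries between two successive values.
    have hL : ∀ x ∈ (s.drop j).take (q + 1), s[j + q] ≤ x ∧ x ≤ s[j + q] + 1 := by
      intro x hx
      obtain ⟨u, hu, rfl⟩ := List.getElem_of_mem hx
      simp only [List.length_take, List.length_drop] at hu
      rw [List.getElem_take, List.getElem_drop]
      have h1 := hmono (j + u) (j + q) (by omega) (by omega) (by omega)
      have h2 := hmono j (j + u) (by omega) (by omega) (by omega)
      omega
    have h1 := count_add_count_succ_eq_length hL
    have hsub : ((s.drop j).take (q + 1)).Sublist s :=
      (List.take_sublist _ _).trans (List.drop_sublist _ _)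
    have h2 := hsub.count_le s[j + q]
    have h3 := hsub.count_le (s[j + q] + 1)
    have h4 := h s[j + q]
    simp only [List.length_take, List.length_drop] at h1
    omega

/-- The multiset in which the members of a list are the multiplicities of `k`, `k + 1`, …. -/
def partsOfList : ℕ → List ℕ → Multiset ℕ
  | _, [] => 0
  | k, c :: l => Multiset.replicate c k + partsOfList (k + 1) l

theorem sum_partsOfList (k : ℕ) (l : List ℕ) : (partsOfList k l).sum = listWeight k l := by
  induction l generalizing k with
  | nil => rfl
  | cons c l ih => simp [partsOfList, listWeight, ih, mul_comm]

theorem count_partsOfList (k : ℕ) (l : List ℕ) (j : ℕ) :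
    (partsOfList k l).count j = if k ≤ j then l.getD (j - k) 0 else 0 := by
  induction l generalizing k with
  | nil => simp [partsOfList]
  | cons c l ih =>
    rw [partsOfList, Multiset.count_add, ih, Multiset.count_replicate]
    rcases lt_trichotomy k j with h | rfl | h
    · obtain ⟨d, rfl⟩ : ∃ d, j = k + 1 + d := ⟨j - (k + 1), by omega⟩
      rw [if_neg (by omega), if_pos (by omega), if_pos (by omega),
        show k + 1 + d - k = d + 1 by omega, List.getD_cons_succ, zero_add,
        Nat.add_sub_cancel_left]
    · simp
    · rw [if_neg (by omega), if_neg (by omega), if_neg (by omega)]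

/-- The list of the multiplicities of the parts of a partition of `N`, preceded by `a`. -/
def multiplicities {N : ℕ} (a : ℕ) (p : N.Partition) : List ℕ :=
  a :: (List.range N).map fun j => p.parts.count (j + 1)

theorem count_zero_parts {N : ℕ} (p : N.Partition) : p.parts.count 0 = 0 :=
  Multiset.count_eq_zero_of_notMem fun h => lt_irrefl 0 (p.parts_pos h)

theorem getD_multiplicities {N : ℕ} (a : ℕ) (p : N.Partition) (j : ℕ) :
    (multiplicities a p).getD (j + 1) 0 = p.parts.count (j + 1) := by
  rw [multiplicities, List.getD_cons_succ]
  rcases lt_or_ge j N with hj | hj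
  · rw [List.getD_eq_getElem _ _ (by simpa using hj)]
    simp
  · rw [List.getD_eq_default _ _ (by simpa using hj)]
    symm
    refine Multiset.count_eq_zero_of_notMem fun h => ?_
    have h1 := Multiset.le_sum_of_mem h
    rw [p.parts_sum] at h1
    omega

theorem listWeight_multiplicities {N : ℕ} (a : ℕ) (p : N.Partition) :
    listWeight 0 (multiplicities a p) = N := by
  rw [listWeight_zero, ← sum_partsOfList]
  refine Eq.trans (congrArg _ ?_) p.parts_sum
  ext j
  rw [count_partsOfList]
  rcases j with _ | j
  · simp [count_zero_parts]
  · rw [if_pos (by omega), ← getD_multiplicities a]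
    simp [multiplicities]

theorem multiplicities_injective {N : ℕ} (a : ℕ) :
    Function.Injective (multiplicities a : N.Partition → List ℕ) := by
  intro p p' h
  ext j
  rcases j with _ | j
  · rw [count_zero_parts, count_zero_parts]
  · rw [← getD_multiplicities a, ← getD_multiplicities a, h]

theorem exists_multiplicities {f : List ℕ} {a N : ℕ} (ha : f.headD 0 = a)
    (hN : listWeight 0 f = N) :
    ∃ p : N.Partition, ∀ j, (multiplicities a p).getD j 0 = f.getD j 0 := by
  refine ⟨⟨partsOfList 1 f.tail, ?_, ?_⟩, ?_⟩
  · intro j hj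
    rw [← Multiset.count_pos, count_partsOfList] at hj
    split_ifs at hj with h <;> omega
  · rw [sum_partsOfList, ← listWeight_zero, hN]
  · rintro (_ | j)
    · subst ha
      cases f <;> simp [multiplicities]
    · rw [getD_multiplicities, count_partsOfList, if_pos (by omega)]
      cases f <;> simp

theorem isEPartition_iff {K κ ε i : ℕ} (hε : ε = 0 ∨ ε = 1) (hκ : K + ε = 2 * κ)
    (hi₁ : 1 ≤ i) (hi₂ : i ≤ κ) {N : ℕ} (p : N.Partition) :
    IsEPartition K i p ↔ EvenOnOdd false (multiplicities (2 * κ - 2 * i) p) ∧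
      NeighboursLe (K - 1) (multiplicities (2 * κ - 2 * i) p) := by
  have hsort : (sortedParts p).Pairwise (· ≥ ·) := Multiset.pairwise_sort _ _
  have hcount : ∀ a, (sortedParts p).count a = p.parts.count a := fun a => by
    rw [← Multiset.coe_count, sortedParts, Multiset.sort_eq]
  have hodd : EvenOnOdd false (multiplicities (2 * κ - 2 * i) p) ↔
      ∀ a, Odd a → Even (p.parts.count a) := by
    rw [(evenOnOdd_iff_getD _).2]
    refine forall_congr' fun j => ?_
    rcases j with _ | j
    · simp
    · rw [getD_multiplicities]
  have hhead : (multiplicities (2 * κ - 2 * i) p).getD 0 0 = 2 * κ - 2 * i := rfl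
  -- For ε = 1 the two bounds coincide; for ε = 0 the right one allows 2i − 1 ones, and evenness
  -- excludes this value.
  have hones : Even (p.parts.count 1) →
      (p.parts.count 1 ≤ 2 * i - 2 ↔ 2 * κ - 2 * i + p.parts.count 1 ≤ K - 1) := by
    rintro ⟨c, hc⟩
    omega
  rw [neighboursLe_iff_getD, hodd]
  constructor
  · rintro ⟨h1, h2, h3⟩
    refine ⟨h1, ?_⟩
    rw [difference_iff_count hsort] at h2
    rintro (_ | j)
    · rw [hhead, getD_multiplicities]
      exact (hones (h1 1 odd_one)).1 h3
    · rw [getD_multiplicities, getD_multiplicities, ← hcount, ← hcount]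
      exact h2 _
  · rintro ⟨h1, h2⟩
    have h0 := h2 0
    rw [hhead, getD_multiplicities] at h0
    refine ⟨h1, ?_, (hones (h1 1 odd_one)).2 h0⟩
    rw [difference_iff_count hsort]
    -- For the value 0, which is no part, only the number of ones matters, and `h0` bounds it.
    rintro (_ | j)
    · rw [hcount, hcount, count_zero_parts]
      simp only [zero_add] at h0 ⊢
      omega
    · have := h2 (j + 1)
      rwa [getD_multiplicities, getD_multiplicities, ← hcount, ← hcount] at this

/-! ### The bijection and the count -/

theorem bijOn_path_multiplicities {K κ ε i : ℕ} (hε : ε = 0 ∨ ε = 1)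
    (hκ : K + ε = 2 * κ) (hi₁ : 1 ≤ i) (hi₂ : i ≤ κ) (N : ℕ) :
    Set.BijOn (fun p : N.Partition => path (multiplicities (2 * κ - 2 * i) p))
      {p | IsEPartition K i p} (restrictedPaths K (2 * κ - 2 * i) N) := by
  have ha : 2 * κ - 2 * i ≤ K - 1 := by omega
  have he : Even (2 * κ - 2 * i) := ⟨κ - i, by omega⟩
  refine ⟨fun p hp => ⟨?_, ?_, ?_⟩, ?_, ?_⟩
  · exact (isRestrictedPath_path_iff (f := multiplicities _ p) ha he).2 ((isEPartition_iff hε hκ hi₁ hi₂ p).1 hp)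
  · rw [height_path]; rfl
  · rw [weight_path, listWeight_multiplicities]
  · intro p _ p' _ h
    exact multiplicities_injective _ (eq_of_path_eq h (by simp [multiplicities]))
  · rintro y ⟨hy, hy0, hyN⟩
    obtain ⟨f, rfl⟩ := exists_path_eq
      ⟨hy.has_vertex, hy.moves, hy.ends_on_axis, hy.last_move⟩
    rw [height_path, Function.iterate_zero_apply] at hy0
    rw [weight_path] at hyN
    obtain ⟨p, hp⟩ := exists_multiplicities hy0 hyN
    have hpf := path_eq_of_getD_eq hp
    refine ⟨p, ?_, hpf⟩
    rw [← hpf] at hy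
    exact (isEPartition_iff hε hκ hi₁ hi₂ p).2 ((isRestrictedPath_path_iff (f := multiplicities _ p) ha he).1 hy)

theorem finsum_ncard_fiber {α : Type*} {S : Set α} (hS : S.Finite) (g : α → ℕ) :
    ∑ᶠ m : ℕ, {y ∈ S | g y = m}.ncard = S.ncard := by
  classical
  lift S to Finset α using hS
  have h : ∀ m, {y ∈ (S : Set α) | g y = m}.ncard = (S.filter fun y => g y = m).card := by
    intro m
    rw [← Set.ncard_coe_finset, Finset.coe_filter]
    rfl
  simp only [h]
  rw [finsum_eq_sum_of_support_subset (s := S.image g), Set.ncard_coe_finset,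
    ← Finset.card_eq_sum_card_image]
  intro m hm
  obtain ⟨y, hy⟩ := Finset.card_ne_zero.1 hm
  rw [Finset.mem_filter] at hy
  exact Finset.mem_coe.2 (Finset.mem_image.2 ⟨y, hy.1, hy.2⟩)

theorem proposition5 (K κ ε i : ℕ) (hK : 2 < K) (hε : ε = 0 ∨ ε = 1) (hκ : K + ε = 2 * κ)
    (hi₁ : 1 ≤ i) (hi₂ : i ≤ κ) (n : ℕ) :
    (restrictedPaths K (2 * κ - 2 * i) (2 * n)).Finite ∧
      pathNumber K κ i (2 * n) = partitionNumber K i (2 * n) := by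
  have hb := bijOn_path_multiplicities hε hκ hi₁ hi₂ (2 * n)
  have hE : {p : (2 * n).Partition | IsEPartition K i p}.Finite := Set.toFinite _
  have hP : (restrictedPaths K (2 * κ - 2 * i) (2 * n)).Finite := hb.image_eq ▸ hE.image _
  refine ⟨hP, ?_⟩
  rw [pathNumber, partitionNumber]
  refine (finsum_ncard_fiber hP charge).trans (Eq.trans ?_
    (finsum_ncard_fiber hE fun p => p.parts.card).symm)
  rw [← hb.image_eq, hb.injOn.ncard_image]
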